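/- Let $k$ be a field of characteristic $p>0$. All rings are commutative and tensor products are over $k$. For a ring $R$ of characteristic $p$ write $F^e_*R$ for $R$ viewed as an $R$-module through the $e$-th iterated Frobenius $r\mapsto r^{p^e}$, put $\mathscr C_{e,R}=\operatorname{Hom}_R(F^e_*R,R)$, and let $\mathscr C_R=\bigoplus_{e\ge 0}\mathscr C_{e,R}$ be the full Cartier algebra of $R$. For a $k$-algebra $R$ and an integer $n\ge 1$, let $\Delta_n\colon R^{\otimes n}\to R$ be the multiplication map $r_1\otimes\cdots\otimes r_n\mapsto r_1\cdots r_n$. The $n$-th diagonal Cartier algebra $\mathscr D^{(n)}(R)\subseteq\mathscr C_R$ consists, in degree $e$, of those $\varphi\in\mathscr C_{e,R}$ for which there is $\widehat\varphi\in\mathscr C_{e,R^{\otimes n}}$ with $\Delta_n\circ\widehat\varphi=\varphi\circ F^e_*\Delta_n$. A Cartier subalgebra $\mathscr C\subseteq\mathscr C_R$ is called $F$-regular if its test ideal $$\tau(R,\mathscr C)=\{c\in R : \text{for every } r\in R \text{ lying in no minimal prime of } R \text{ there are } e>0 \text{ and } \varphi\in\mathscr C_e \text{ with } \varphi(F^e_*r)=c\}$$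 equals $R$. The ring $R$ is strongly $F$-regular if $\mathscr C_R$ is $F$-regular; the $k$-algebra $R$ is $n$-diagonally $F$-regular if $\mathscr D^{(n)}(R)$ is $F$-regular, and diagonally $F$-regular if this holds for all $n\ge 1$. A $k$-algebra is essentially smooth if it is a localization of a smooth $k$-algebra. **Proposition 5.1.** Let $R$ be a $k$-algebra. 1. If $R$ is essentially smooth over $k$, then $R$ is diagonally $F$-regular. 2. If $R$ is essentially of finite type over $k$ and $n$-diagonally $F$-regular for some integer $n\ge 1$, then $R$ is strongly $F$-regular, normal (all localizations at primes are integrally closed domains) and Cohen–Macaulay. -/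

import Mathlib

universe u v

namespace DiagFReg

open scoped TensorProduct

/-- `IsCartierMap p e φ`: the additive map `φ : R → R` is `p⁻ᵉ`-linear, i.e.
`φ (a ^ (p ^ e) * b) = a * φ b`. For `R` of characteristic `p` these are exactly the `R`-linear
maps `F^e_* R → R`, where `F^e_* R` is `R` with the module structure given by restriction of
scalars along the `e`-th iterate of Frobenius. -/
def IsCartierMap (p : ℕ) {R : Type v} [CommRing R] (e : ℕ) (φ : R →+ R) : Prop :=
  ∀ a b : R, φ (a ^ (p ^ e) * b) = a * φ b

/-- The group `Hom_R(F^e_* R, R)`. -/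
def cartierMaps (p : ℕ) (R : Type v) [CommRing R] (e : ℕ) : AddSubgroup (R →+ R) where
  carrier := {φ | IsCartierMap p e φ}
  zero_mem' := by intro a b; simp
  add_mem' := by
    intro φ ψ hφ hψ a b
    simp only [AddMonoidHom.add_apply, hφ a b, hψ a b, mul_add]
  neg_mem' := by
    intro φ hφ a b
    simp only [AddMonoidHom.neg_apply, hφ a b, mul_neg]

theorem IsCartierMap.comp {p : ℕ} {R : Type v} [CommRing R] {d e : ℕ} {φ ψ : R →+ R}
    (hφ : IsCartierMap p d φ) (hψ : IsCartierMap p e ψ) :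
    IsCartierMap p (d + e) (φ.comp ψ) := by
  intro a b
  have h : a ^ (p ^ (d + e)) = (a ^ (p ^ d)) ^ (p ^ e) := by
    rw [pow_add, pow_mul]
  rw [AddMonoidHom.comp_apply, AddMonoidHom.comp_apply, h, hψ (a ^ (p ^ d)) b, hφ a (ψ b)]

theorem isCartierMap_mulLeft (p : ℕ) {R : Type v} [CommRing R] (a : R) :
    IsCartierMap p 0 (AddMonoidHom.mulLeft a) := by
  intro b c
  rw [AddMonoidHom.coe_mulLeft, pow_zero, pow_one]
  ring

/-- A Cartier subalgebra of the full Cartier algebra `⨁ₑ Hom_R(F^e_* R, R)`. In degree zero it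
is `R`, acting by multiplication, and it is closed under the product `φ · ψ = φ ∘ F^d_* ψ`. The
left and right multiplications by elements of `R` are the products with elements of degree zero,
so closure under them is included. -/
structure CartierSubalgebra (p : ℕ) (R : Type v) [CommRing R] where
  deg : ℕ → AddSubgroup (R →+ R)
  deg_le : ∀ e, deg e ≤ cartierMaps p R e
  mulLeft_mem : ∀ a : R, AddMonoidHom.mulLeft a ∈ deg 0
  comp_mem : ∀ {d e : ℕ} {φ ψ : R →+ R}, φ ∈ deg d → ψ ∈ deg e → φ.comp ψ ∈ deg (d + e)

/-- The full Cartier algebra of `R`. -/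
def fullCartierAlgebra (p : ℕ) (R : Type v) [CommRing R] : CartierSubalgebra p R where
  deg := cartierMaps p R
  deg_le _ := le_rfl
  mulLeft_mem a := isCartierMap_mulLeft p a
  comp_mem hφ hψ := IsCartierMap.comp hφ hψ

/-- The `n`-fold tensor power `R ⊗ ⋯ ⊗ R` over `k`, a commutative `k`-algebra. -/
abbrev TensorPow (k : Type u) (R : Type v) [Field k] [CommRing R] [Algebra k R] (n : ℕ) :
    Type (max u v) :=
  PiTensorProduct k (fun _ : Fin n => R)

/-- The diagonal map `Δₙ : r₁ ⊗ ⋯ ⊗ rₙ ↦ r₁ ⋯ rₙ`. -/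
noncomputable def diagonalMap (k : Type u) (R : Type v) [Field k] [CommRing R] [Algebra k R]
    (n : ℕ) : TensorPow k R n →ₐ[k] R :=
  PiTensorProduct.liftAlgHom (MultilinearMap.mkPiAlgebra k (Fin n) R)
    (by simp) (by intro x y; simp [Finset.prod_mul_distrib])

theorem diagonalMap_tprod (k : Type u) (R : Type v) [Field k] [CommRing R] [Algebra k R]
    (n : ℕ) (r : Fin n → R) :
    diagonalMap k R n (PiTensorProduct.tprod k r) = ∏ i, r i := by
  simp [diagonalMap, PiTensorProduct.liftAlgHom]

theorem diagonalMap_surjective (k : Type u) (R : Type v) [Field k] [CommRing R] [Algebra k R]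
    (n : ℕ) [NeZero n] : Function.Surjective (diagonalMap k R n) := by
  intro a
  refine ⟨PiTensorProduct.tprod k (Function.update 1 (0 : Fin n) a), ?_⟩
  rw [diagonalMap_tprod, Finset.prod_update_of_mem (Finset.mem_univ _)]
  simp

/-- The `n`-th diagonal Cartier algebra of `R` over `k` (`n ≥ 1`). In degree `e` it consists of
the `φ : F^e_* R → R` that admit a lift `ψ : F^e_* (R ⊗ ⋯ ⊗ R) → R ⊗ ⋯ ⊗ R` along `Δₙ`, i.e.
`Δₙ ∘ ψ = φ ∘ Δₙ`; equivalently, `φ` is induced by a `ψ` with `ψ(ker Δₙ) ⊆ ker Δₙ`. -/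
noncomputable def diagonalCartierAlgebra (p : ℕ) (k : Type u) (R : Type v) [Field k] [CommRing R]
    [Algebra k R] (n : ℕ) [NeZero n] : CartierSubalgebra p R where
  deg e :=
    { carrier := {φ | φ ∈ cartierMaps p R e ∧ ∃ ψ ∈ cartierMaps p (TensorPow k R n) e,
        ∀ x, diagonalMap k R n (ψ x) = φ (diagonalMap k R n x)}
      zero_mem' := ⟨zero_mem _, 0, zero_mem _, by simp⟩
      add_mem' := by
        rintro φ φ' ⟨hφ, ψ, hψ, h⟩ ⟨hφ', ψ', hψ', h'⟩
        exact ⟨add_mem hφ hφ', ψ + ψ', add_mem hψ hψ', fun x => by simp [h, h']⟩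
      neg_mem' := by
        rintro φ ⟨hφ, ψ, hψ, h⟩
        exact ⟨neg_mem hφ, -ψ, neg_mem hψ, fun x => by simp [h]⟩ }
  deg_le _ _ hφ := hφ.1
  mulLeft_mem a := by
    obtain ⟨b, rfl⟩ := diagonalMap_surjective k R n a
    exact ⟨isCartierMap_mulLeft p _, AddMonoidHom.mulLeft b, isCartierMap_mulLeft p _,
      fun x => by simp⟩
  comp_mem := by
    rintro d e φ φ' ⟨hφ, ψ, hψ, h⟩ ⟨hφ', ψ', hψ', h'⟩
    exact ⟨IsCartierMap.comp hφ hφ', ψ.comp ψ', IsCartierMap.comp hψ hψ',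
      fun x => by simp [h, h']⟩

/-- The test ideal of a Cartier subalgebra `C`: all `c` such that every `r ∈ R°` (every `r` lying
in no minimal prime of `R`) is sent to `c` by some `φ ∈ C` homogeneous of positive degree. -/
def testIdeal {p : ℕ} {R : Type v} [CommRing R] (C : CartierSubalgebra p R) : Set R :=
  {c | ∀ r : R, (∀ P ∈ minimalPrimes R, r ∉ P) → ∃ e : ℕ, 0 < e ∧ ∃ φ ∈ C.deg e, φ r = c}

/-- `C` is `F`-regular if its test ideal is all of `R`. -/
def IsFRegular {p : ℕ} {R : Type v} [CommRing R] (C : CartierSubalgebra p R) : Prop :=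
  testIdeal C = Set.univ

/-- `R` is strongly `F`-regular if its full Cartier algebra is `F`-regular. -/
def IsStronglyFRegular (p : ℕ) (R : Type v) [CommRing R] : Prop :=
  IsFRegular (fullCartierAlgebra p R)

/-- `R` is `n`-diagonally `F`-regular over `k`. -/
def IsNDiagonallyFRegular (p : ℕ) (k : Type u) (R : Type v) [Field k] [CommRing R] [Algebra k R]
    (n : ℕ) [NeZero n] : Prop :=
  IsFRegular (diagonalCartierAlgebra p k R n)

/-- `R` is diagonally `F`-regular over `k`. -/
def IsDiagonallyFRegular (p : ℕ) (k : Type u) (R : Type v) [Field k] [CommRing R]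
    [Algebra k R] : Prop :=
  ∀ (n : ℕ) [NeZero n], IsNDiagonallyFRegular p k R n

/-- `R` is essentially smooth over `k`: it is a localization of a smooth `k`-algebra `S`. Finitely
generated `k`-algebras have models in the universe of `k`, so the universe of `S` is no
restriction. -/
def IsEssentiallySmooth (k : Type u) (R : Type v) [Field k] [CommRing R] [Algebra k R] : Prop :=
  ∃ (S : Type u) (_ : CommRing S) (_ : Algebra k S) (_ : Algebra S R) (_ : IsScalarTower k S R)
    (M : Submonoid S), Algebra.Smooth k S ∧ IsLocalization M R

/-- A ring is normal if its localizations at primes are integrally closed domains. -/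
def IsNormalRing (R : Type v) [CommRing R] : Prop :=
  ∀ (P : Ideal R) [P.IsPrime],
    IsDomain (Localization.AtPrime P) ∧ IsIntegrallyClosed (Localization.AtPrime P)

/-- A local ring is Cohen–Macaulay if its maximal ideal contains a regular sequence whose length
is the Krull dimension of the ring. -/
def IsCohenMacaulayLocal (A : Type v) [CommRing A] [IsLocalRing A] : Prop :=
  ∃ xs : List A, (∀ x ∈ xs, x ∈ IsLocalRing.maximalIdeal A) ∧
    RingTheory.Sequence.IsRegular A xs ∧ (xs.length : WithBot ℕ∞) = ringKrullDim A

/-- A (Noetherian) ring is Cohen–Macaulay if its localizations at primes are. -/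
def IsCohenMacaulayRing (R : Type v) [CommRing R] : Prop :=
  ∀ (P : Ideal R) [P.IsPrime], IsCohenMacaulayLocal (Localization.AtPrime P)

end DiagFReg

/-! ### Cartier maps as linear forms on F^e_* R, and what projectivity of F^e_* R gives. -/

namespace DiagFReg
open scoped TensorProduct

/-! Part 1 rests on one fact: if T is formally smooth and essentially of finite type over k, then
F^e_* T is a projective T-module, possibly of infinite rank since k need not be F-finite
(`projective_fPush_of_essFiniteType`). Applied to the n-th tensor power of R, it lets every Cartier
map of R lift along the diagonal (`exists_cartierMap_lift`), so the diagonal Cartier algebra is the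
full one. Applied to R itself, together with Krull's intersection theorem, it gives a Cartier map
sending a prescribed r outside the minimal primes to 1 (`exists_cartierMap_eq_one`).

In part 2, strong F-regularity is immediate because the diagonal Cartier algebra lies in the full
one. It makes R reduced and its localizations A at primes domains in which every nonzero element is
sent to 1 by some Cartier map (`IsStronglyFRegular.exists_eq_one_localization`). Such a map turns c
* x^q in A into x in A, which gives normality.

For Cohen–Macaulayness, write A as a localization of a finitely generated algebra B, finite over a
polynomial ring S. Some nonzero c in S has multiplication by c on B factoring through a free
S-module. Combining Frobenius on B with a Cartier map sending c to 1 factors the inclusion of B in A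
through a finite power of F^e_* S, which is projective. Hence A is flat over S
(`flat_of_exists_cartierMap`), regular parameters of a localization of S form a regular sequence in
A, and integrality makes the fibre zero-dimensional (`isCohenMacaulayLocal_of_flat`). -/

/-- The ring `R`, to be viewed as an `R`-module through the `e`-th iterate of the Frobenius. -/
def FPush (_p _e : ℕ) (R : Type*) : Type _ := R

namespace FPush

variable {p e : ℕ} {R : Type*} [CommRing R]

instance : AddCommGroup (FPush p e R) := inferInstanceAs (AddCommGroup R)

/-- The identity `R → F^e_* R`. -/
def of (p e : ℕ) {R : Type*} [CommRing R] : R ≃+ FPush p e R := AddEquiv.refl R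

instance module [ExpChar R p] : Module R (FPush p e R) :=
  Module.compHom R (iterateFrobenius R p e)

theorem smul_of [ExpChar R p] (a b : R) : a • of p e b = of p e (a ^ p ^ e * b) := rfl

/-- Cartier maps are linear forms on `F^e_* R`. -/
def linearMap [ExpChar R p] {φ : R →+ R} (hφ : φ ∈ cartierMaps p R e) : FPush p e R →ₗ[R] R where
  toFun x := φ ((of p e).symm x)
  map_add' x y := by simp
  map_smul' a x := hφ a _

/-- The additive map underlying a linear form on `F^e_* R`. -/
def addHom [ExpChar R p] (f : FPush p e R →ₗ[R] R) : R →+ R :=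
  f.toAddMonoidHom.comp (of p e).toAddMonoidHom

theorem addHom_apply [ExpChar R p] (f : FPush p e R →ₗ[R] R) (x : R) :
    addHom f x = f (of p e x) := rfl

theorem addHom_mem [ExpChar R p] (f : FPush p e R →ₗ[R] R) : addHom f ∈ cartierMaps p R e := by
  intro a b
  rw [addHom_apply, addHom_apply, ← smul_of, map_smul, smul_eq_mul]

end FPush

/-- The composite of φ with d is a T-linear map F^e_* T → R; projectivity lifts it through the
surjection T → R. -/
theorem exists_cartierMap_lift {p e : ℕ} {R : Type v} {T : Type*} [CommRing R] [CommRing T]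
    [ExpChar R p] [ExpChar T p] [Module.Projective T (FPush p e T)] (d : T →+* R)
    (hd : Function.Surjective d) {φ : R →+ R} (hφ : φ ∈ cartierMaps p R e) :
    ∃ ψ ∈ cartierMaps p T e, ∀ x, d (ψ x) = φ (d x) := by
  algebraize [d]
  let g : FPush p e T →ₗ[T] R :=
    { toFun x := φ (d ((FPush.of p e).symm x))
      map_add' x y := by simp
      map_smul' a x := by
        obtain ⟨x, rfl⟩ := (FPush.of p e).surjective x
        rw [FPush.smul_of, AddEquiv.symm_apply_apply, AddEquiv.symm_apply_apply, map_mul, map_pow,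
          hφ, Algebra.smul_def]
        rfl }
  obtain ⟨f, hf⟩ := Module.projective_lifting_property (Algebra.linearMap T R) g hd
  exact ⟨FPush.addHom f, FPush.addHom_mem f, fun x => LinearMap.congr_fun hf (FPush.of p e x)⟩

/-- The ideal of values at `r` of the Cartier maps of degree `e`. -/
def evalIdeal (p e : ℕ) {R : Type*} [CommRing R] (r : R) : Ideal R where
  carrier := {c | ∃ φ ∈ cartierMaps p R e, φ r = c}
  zero_mem' := ⟨0, zero_mem _, rfl⟩
  add_mem' := by
    rintro _ _ ⟨φ, hφ, rfl⟩ ⟨ψ, hψ, rfl⟩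
    exact ⟨φ + ψ, add_mem hφ hψ, rfl⟩
  smul_mem' := by
    rintro a _ ⟨φ, hφ, rfl⟩
    have h := (isCartierMap_mulLeft p a).comp hφ
    rw [zero_add] at h
    exact ⟨_, h, rfl⟩

/-- A section of a free cover expands x with coefficients that are linear forms evaluated at x. If
all of these lay in I, so would x in I • M. No finiteness of M is needed. -/
theorem exists_linearForm_notMem {R M : Type*} [CommRing R] [AddCommGroup M] [Module R M]
    [Module.Projective R M] {I : Ideal R} {x : M} (hx : x ∉ I • (⊤ : Submodule R M)) :
    ∃ f : M →ₗ[R] R, f x ∉ I := by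
  obtain ⟨s, hs⟩ := Module.projective_def'.1 (inferInstance : Module.Projective R M)
  by_contra! h
  refine hx ?_
  have : Finsupp.linearCombination R id (s x) = x := LinearMap.congr_fun hs x
  rw [← this, Finsupp.linearCombination_apply]
  exact Submodule.sum_mem _ fun i _ =>
    Submodule.smul_mem_smul (h (Finsupp.lapply i ∘ₗ s)) trivial

theorem evalIdeal_not_le {p e : ℕ} {R : Type*} [CommRing R] [ExpChar R p]
    [Module.Projective R (FPush p e R)] {I : Ideal R} {r : R} (hr : r ∉ I ^ p ^ e) :
    ¬ evalIdeal p e r ≤ I := by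
  have hx : FPush.of p e r ∉ I • (⊤ : Submodule R (FPush p e R)) := by
    intro h
    have : (FPush.of p e).symm (FPush.of p e r) ∈ I ^ p ^ e := by
      refine Submodule.smul_induction_on h ?_ ?_
      · rintro a ha x -
        obtain ⟨x, rfl⟩ := (FPush.of p e).surjective x
        rw [FPush.smul_of]
        exact Ideal.mul_mem_right _ _ (Ideal.pow_mem_pow ha _)
      · intro x y hx hy
        exact add_mem (S := Ideal R) hx hy
    exact hr this
  obtain ⟨f, hf⟩ := exists_linearForm_notMem hx
  exact fun h => hf (h ⟨FPush.addHom f, FPush.addHom_mem f, rfl⟩)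

/-- By Krull's intersection theorem, an r in all powers of m satisfies (1 - a) * r = 0 with a in m.
A minimal prime below m cannot contain 1 - a, so it contains r. -/
theorem exists_notMem_pow_of_notMem_minimalPrimes {R : Type*} [CommRing R] [IsNoetherianRing R]
    {r : R} (hr : ∀ P ∈ minimalPrimes R, r ∉ P) (m : Ideal R) [m.IsPrime] : ∃ n, r ∉ m ^ n := by
  by_contra! h
  have h' : r ∈ (⨅ i : ℕ, m ^ i • ⊤ : Submodule R R) := by
    simpa [Submodule.mem_iInf] using h
  obtain ⟨⟨a, ha⟩, hra⟩ := (Ideal.mem_iInf_smul_pow_eq_bot_iff m r).1 h'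
  obtain ⟨Q, hQ, hQm⟩ := Ideal.exists_minimalPrimes_le (bot_le : (⊥ : Ideal R) ≤ m)
  have hQp : Q.IsPrime := hQ.1.1
  have h0 : (1 - a) * r = 0 := by
    have : a * r = r := hra
    rw [sub_mul, this, one_mul, sub_self]
  rcases hQp.mem_or_mem (h0 ▸ Q.zero_mem : (1 - a) * r ∈ Q) with h1 | h1
  · refine Ideal.IsPrime.ne_top (I := m) inferInstance ((Ideal.eq_top_iff_one m).2 ?_)
    simpa using add_mem (hQm h1) ha
  · exact hr Q hQ h1

theorem exists_cartierMap_eq_one {p : ℕ} [Fact p.Prime] {R : Type*} [CommRing R] [ExpChar R p]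
    [IsNoetherianRing R] (hR : ∀ e, Module.Projective R (FPush p e R)) {r : R}
    (hr : ∀ P ∈ minimalPrimes R, r ∉ P) :
    ∃ e, 0 < e ∧ ∃ φ ∈ cartierMaps p R e, φ r = 1 := by
  have hp : 1 < p := (Fact.out : p.Prime).one_lt
  obtain ⟨σ, hσ, hσ1⟩ : (1 : R) ∈ evalIdeal p 1 (1 : R) := by
    rw [← Ideal.eq_top_iff_one]
    by_contra h
    obtain ⟨m, hm, hle⟩ := Ideal.exists_le_maximal _ h
    refine evalIdeal_not_le (fun h1 => hm.ne_top ((Ideal.eq_top_iff_one m).2 ?_)) hle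
    exact Ideal.pow_le_self (by positivity) h1
  -- The index e + 1 keeps the degree positive. To raise the degree of φ by one without changing its
  -- value at r, precompose with σ(r^(p-1) · -), which fixes r because σ 1 = 1.
  have hmono : Monotone fun e => evalIdeal p (e + 1) r := by
    refine monotone_nat_of_le_succ ?_
    rintro e _ ⟨φ, hφ, rfl⟩
    have h1 := IsCartierMap.comp hφ (IsCartierMap.comp hσ (isCartierMap_mulLeft p (r ^ (p - 1))))
    refine ⟨_, h1, ?_⟩
    have h2 : r ^ (p - 1) * r = r ^ p ^ 1 * 1 := by
      rw [← pow_succ, Nat.sub_add_cancel hp.le, pow_one, mul_one]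
    rw [AddMonoidHom.comp_apply, AddMonoidHom.comp_apply, AddMonoidHom.coe_mulLeft, h2, hσ, hσ1,
      mul_one]
  have htop : (⨆ e, evalIdeal p (e + 1) r) = ⊤ := by
    by_contra h
    obtain ⟨m, hm, hle⟩ := Ideal.exists_le_maximal _ h
    obtain ⟨n, hn⟩ := exists_notMem_pow_of_notMem_minimalPrimes hr m
    refine evalIdeal_not_le (p := p) (e := n + 1) (fun h1 => hn ?_)
      ((le_iSup (fun e => evalIdeal p (e + 1) r) n).trans hle)
    exact Ideal.pow_le_pow_right ((Nat.lt_pow_self hp).le.trans'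
      (Nat.le_succ n)) h1
  have h1 : (1 : R) ∈ ⨆ e, evalIdeal p (e + 1) r := htop ▸ Submodule.mem_top
  obtain ⟨e, φ, hφ, h⟩ := (Submodule.mem_iSup_of_directed _ hmono.directed_le).1 h1
  exact ⟨e + 1, Nat.succ_pos e, φ, hφ, h⟩

end DiagFReg

/-! ### Projectivity of F^e_* for polynomial rings over any field. -/

namespace DiagFReg
open scoped TensorProduct

/-- Division of exponents by q = p^e and a k-basis b of F^e_* k write F^e_* of the polynomial ring
in terms of the elements x^(res β) b_i. The target M allows every exponent as an index, not only
those below q, so the map to M is merely a section; this suffices for projectivity. -/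
theorem projective_fPush_mvPolynomial (p e : ℕ) [Fact p.Prime] (σ : Type*) (k : Type*) [Field k]
    [ExpChar k p] [ExpChar (MvPolynomial σ k) p] :
    Module.Projective (MvPolynomial σ k) (FPush p e (MvPolynomial σ k)) := by
  classical
  set q := p ^ e with hq
  have hq0 : 0 < q := pow_pos (Fact.out : p.Prime).pos e
  let b := Module.Free.chooseBasis k (FPush p e k)
  let ι := Module.Free.ChooseBasisIndex k (FPush p e k)
  let M := ((σ →₀ ℕ) × ι) →₀ MvPolynomial σ k
  let quo : (σ →₀ ℕ) → (σ →₀ ℕ) := Finsupp.mapRange (· / q) (Nat.zero_div q)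
  let res : (σ →₀ ℕ) → (σ →₀ ℕ) := Finsupp.mapRange (· % q) (Nat.zero_mod q)
  let L (β : σ →₀ ℕ) : FPush p e k →ₗ[k] M :=
    (Finsupp.linearCombination k fun i =>
      (Finsupp.single (res β, i) (MvPolynomial.monomial (quo β) 1) : M)) ∘ₗ b.repr.toLinearMap
  let h0 : MvPolynomial σ k →+ M :=
    (Finsupp.liftAddHom fun β => (L β).toAddMonoidHom.comp (FPush.of p e).toAddMonoidHom).comp
      AddMonoidAlgebra.coeffAddEquiv.toAddMonoidHom
  have h0_monomial (β : σ →₀ ℕ) (a : k) :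
      h0 (MvPolynomial.monomial β a) = L β (FPush.of p e a) := by
    change Finsupp.liftAddHom _ (Finsupp.single β a) = _
    rw [Finsupp.liftAddHom_apply_single]
    rfl
  have hres (α β : σ →₀ ℕ) : res (q • α + β) = res β := by
    ext x; simp [res]
  have hquo (α β : σ →₀ ℕ) : quo (q • α + β) = α + quo β := by
    ext x; simp [quo, Nat.mul_add_div hq0]
  have hL (α β : σ →₀ ℕ) (c : k) (a : FPush p e k) :
      L (q • α + β) (c • a) = MvPolynomial.monomial α c • L β a := by
    simp only [L, LinearMap.comp_apply, Finsupp.linearCombination_apply, hres, hquo,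
      LinearEquiv.coe_coe, map_smul]
    rw [Finsupp.smul_sum, Finsupp.smul_sum]
    refine Finsupp.sum_congr fun i _ => ?_
    rw [smul_comm c, smul_comm (MvPolynomial.monomial α c), Finsupp.smul_single c,
      Finsupp.smul_single (MvPolynomial.monomial α c), smul_eq_mul, MvPolynomial.monomial_mul,
      mul_one, MvPolynomial.smul_monomial, smul_eq_mul, mul_one]
  let h : FPush p e (MvPolynomial σ k) →ₗ[MvPolynomial σ k] M :=
    { toFun x := h0 ((FPush.of p e).symm x)
      map_add' x y := by simp
      map_smul' f x := by
        obtain ⟨x, rfl⟩ := (FPush.of p e).surjective x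
        rw [FPush.smul_of, AddEquiv.symm_apply_apply, AddEquiv.symm_apply_apply, RingHom.id_apply]
        induction f using MvPolynomial.induction_on' with
        | add f g hf hg =>
          rw [add_smul, ← hf, ← hg, ← map_add, ← add_mul, add_pow_expChar_pow]
        | monomial α c =>
          induction x using MvPolynomial.induction_on' with
          | add x y hx hy => rw [mul_add, map_add, map_add, smul_add, hx, hy]
          | monomial β a =>
            rw [MvPolynomial.monomial_pow, MvPolynomial.monomial_mul, h0_monomial, h0_monomial,
              ← hL, FPush.smul_of] }
  let g : M →ₗ[MvPolynomial σ k] FPush p e (MvPolynomial σ k) :=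
    Finsupp.linearCombination _ fun x =>
      FPush.of p e (MvPolynomial.monomial x.1 ((FPush.of p e).symm (b x.2)))
  refine Module.Projective.of_split h g (LinearMap.ext fun x => ?_)
  obtain ⟨x, rfl⟩ := (FPush.of p e).surjective x
  change g (h0 x) = FPush.of p e x
  induction x using MvPolynomial.induction_on' with
  | add x y hx hy => rw [map_add, map_add, map_add, hx, hy]
  | monomial β a =>
    let mβ : FPush p e k →+ FPush p e (MvPolynomial σ k) :=
      (FPush.of p e).toAddMonoidHom.comp
        ((MvPolynomial.monomial β).toAddMonoidHom.comp (FPush.of p e).symm.toAddMonoidHom)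
    change _ = mβ (FPush.of p e a)
    rw [h0_monomial]
    generalize FPush.of p e a = a
    have hβ : β = q • quo β + res β := by
      ext x; simp [quo, res, Nat.div_add_mod]
    conv_rhs => rw [← b.linearCombination_repr a]
    simp only [L, LinearMap.comp_apply, Finsupp.linearCombination_apply, LinearEquiv.coe_coe,
      map_finsuppSum]
    refine Finsupp.sum_congr fun i _ => ?_
    obtain ⟨y, hy⟩ := (FPush.of p e).surjective (b i)
    rw [Finsupp.smul_single, Finsupp.linearCombination_single, ← hy, FPush.smul_of, FPush.smul_of,
      AddEquiv.symm_apply_apply, MvPolynomial.smul_monomial, smul_eq_mul, mul_one,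
      MvPolynomial.monomial_pow, MvPolynomial.monomial_mul, ← hβ]
    rfl

end DiagFReg

/-! ### Localization of F^e_*, and descent of projectivity to formally smooth quotients. -/

namespace DiagFReg
open scoped TensorProduct

section Localization

variable (p e : ℕ) {P V : Type*} [CommRing P] [CommRing V] [Algebra P V] [ExpChar V p]
  [Module P (FPush p e V)] [IsScalarTower P V (FPush p e V)]

theorem FPush.algebra_smul_of (a : P) (b : V) :
    a • FPush.of p e b = FPush.of p e (algebraMap P V a ^ p ^ e * b) := by
  rw [← algebraMap_smul V a, FPush.smul_of]

variable (P V) in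
/-- The map `F^e_* P → F^e_* V` induced by `P → V`. -/
def FPush.map [ExpChar P p] : FPush p e P →ₗ[P] FPush p e V where
  toFun x := FPush.of p e (algebraMap P V ((FPush.of p e).symm x))
  map_add' x y := by simp
  map_smul' a x := by
    obtain ⟨x, rfl⟩ := (FPush.of p e).surjective x
    rw [FPush.smul_of, AddEquiv.symm_apply_apply, AddEquiv.symm_apply_apply, map_mul, map_pow,
      RingHom.id_apply, FPush.algebra_smul_of]

theorem FPush.isLocalizedModule [Fact p.Prime] [ExpChar P p] (W : Submonoid P)
    [IsLocalization W V] : IsLocalizedModule W (FPush.map p e P V) where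
  map_units w := by
    have hu := (IsLocalization.map_units V w).pow (p ^ e)
    obtain ⟨c, hc⟩ := hu.exists_right_inv
    rw [Module.End.isUnit_iff]
    constructor
    · intro x y hxy
      obtain ⟨x, rfl⟩ := (FPush.of p e).surjective x
      obtain ⟨y, rfl⟩ := (FPush.of p e).surjective y
      rw [Module.algebraMap_end_apply, Module.algebraMap_end_apply, FPush.algebra_smul_of,
        FPush.algebra_smul_of] at hxy
      exact congrArg _ (hu.mul_left_cancel ((FPush.of p e).injective hxy))
    · intro y
      obtain ⟨y, rfl⟩ := (FPush.of p e).surjective y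
      refine ⟨FPush.of p e (c * y), ?_⟩
      rw [Module.algebraMap_end_apply, FPush.algebra_smul_of, ← mul_assoc, hc, one_mul]
  surj y := by
    obtain ⟨y, rfl⟩ := (FPush.of p e).surjective y
    obtain ⟨⟨a, w⟩, h⟩ := IsLocalization.surj W y
    -- As w acts by w^(p^e), the fraction a / w is rewritten as w^(p^e - 1) * a over w^(p^e).
    refine ⟨⟨FPush.of p e ((w : P) ^ (p ^ e - 1) * a), w⟩, ?_⟩
    refine (FPush.algebra_smul_of p e (w : P) y).trans (congrArg (FPush.of p e) ?_)
    change _ = algebraMap P V ((w : P) ^ (p ^ e - 1) * a)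
    rw [map_mul, ← h, map_pow, mul_comm y, ← mul_assoc,
      pow_sub_one_mul (pow_ne_zero _ (Fact.out : p.Prime).ne_zero)]
  exists_of_eq := by
    intro x y hxy
    obtain ⟨x, rfl⟩ := (FPush.of p e).surjective x
    obtain ⟨y, rfl⟩ := (FPush.of p e).surjective y
    obtain ⟨c, hc⟩ := IsLocalization.exists_of_eq (M := W) (S := V) (x := x) (y := y) hxy
    refine ⟨c, ?_⟩
    change FPush.of p e ((c : P) ^ p ^ e * x) = FPush.of p e ((c : P) ^ p ^ e * y)
    rw [← pow_sub_one_mul (pow_ne_zero _ (Fact.out : p.Prime).ne_zero), mul_assoc, mul_assoc, hc]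

end Localization

theorem projective_fPush_of_isLocalization (p e : ℕ) {P V : Type*} [CommRing P] [CommRing V]
    [Algebra P V] [ExpChar V p] [Fact p.Prime] [ExpChar P p] (W : Submonoid P)
    [IsLocalization W V] [Module.Projective P (FPush p e P)] :
    Module.Projective V (FPush p e V) := by
  let : Module P (FPush p e V) := Module.compHom _ (algebraMap P V)
  have : IsScalarTower P V (FPush p e V) := IsScalarTower.of_algebraMap_smul fun _ _ => rfl
  have := FPush.isLocalizedModule p e (V := V) W
  exact Module.projective_of_isLocalizedModule W (FPush.map p e P V)

theorem exists_cartierMap_localization (p e : ℕ) {P V : Type*} [CommRing P] [CommRing V]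
    [Algebra P V] [ExpChar V p] [Fact p.Prime] [ExpChar P p] (W : Submonoid P)
    [IsLocalization W V] {φ : P →+ P} (hφ : φ ∈ cartierMaps p P e) :
    ∃ ψ ∈ cartierMaps p V e, ∀ x, ψ (algebraMap P V x) = algebraMap P V (φ x) := by
  let : Module P (FPush p e V) := Module.compHom _ (algebraMap P V)
  have : IsScalarTower P V (FPush p e V) := IsScalarTower.of_algebraMap_smul fun _ _ => rfl
  have := FPush.isLocalizedModule p e (V := V) W
  let f : FPush p e V →ₗ[V] V := IsLocalizedModule.mapExtendScalars W (FPush.map p e P V)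
    (Algebra.linearMap P V) V (FPush.linearMap hφ)
  refine ⟨FPush.addHom f, FPush.addHom_mem f, fun x => ?_⟩
  exact IsLocalizedModule.map_apply W (FPush.map p e P V) (Algebra.linearMap P V)
    (FPush.linearMap hφ) (FPush.of p e x)

/-- Let J be the Frobenius power of ker f. The kernel of V ⧸ J → T is nilpotent, so formal
smoothness gives an algebra section σ. Since T ⊗ F^e_* V receives F^e_* (V ⧸ J), σ exhibits F^e_* T
as a direct summand of this base change of a projective module. -/
theorem projective_fPush_of_formallySmooth (p e : ℕ) [Fact p.Prime] {k V T : Type*} [CommRing k]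
    [CommRing V] [CommRing T] [Algebra k V] [Algebra k T] [Algebra.FormallySmooth k T]
    [ExpChar V p] [ExpChar T p] [Module.Projective V (FPush p e V)] (f : V →ₐ[k] T)
    (hf : Function.Surjective f) (hfg : (RingHom.ker f).FG) :
    Module.Projective T (FPush p e T) := by
  let J : Ideal V := (RingHom.ker f).map (iterateFrobenius V p e)
  have hJ : ∀ x ∈ J, f x = 0 := by
    refine fun x hx => (Ideal.map_le_iff_le_comap.2 fun y hy => ?_ : J ≤ RingHom.ker f) hx
    rw [Ideal.mem_comap, iterateFrobenius_def]
    exact Ideal.pow_mem_of_mem _ hy _ (pow_pos (Fact.out : p.Prime).pos e)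
  let g : (V ⧸ J) →ₐ[k] T := Ideal.Quotient.liftₐ J f hJ
  have hg (v : V) : g (Ideal.Quotient.mk J v) = f v := rfl
  have hgs : Function.Surjective g := fun t => by
    obtain ⟨v, rfl⟩ := hf t
    exact ⟨_, hg v⟩
  have hker : RingHom.ker g = (RingHom.ker f).map (Ideal.Quotient.mk J) := by
    refine le_antisymm (fun x hx => ?_) (Ideal.map_le_iff_le_comap.2 fun y hy => hy)
    obtain ⟨v, rfl⟩ := Ideal.Quotient.mk_surjective x
    exact Ideal.mem_map_of_mem _ hx
  have hnil : IsNilpotent (RingHom.ker g) := by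
    rw [Ideal.FG.isNilpotent_iff_le_nilradical (hker ▸ hfg.map _)]
    intro x hx
    obtain ⟨v, rfl⟩ := Ideal.Quotient.mk_surjective x
    refine ⟨p ^ e, ?_⟩
    rw [← map_pow, Ideal.zero_eq_bot, Ideal.mem_bot, Ideal.Quotient.eq_zero_iff_mem,
      ← iterateFrobenius_def]
    exact Ideal.mem_map_of_mem _ hx
  let σ : T →ₐ[k] V ⧸ J := Algebra.FormallySmooth.liftOfSurjective (AlgHom.id k T) g hgs hnil
  have hσ (x : T) : g (σ x) = x := Algebra.FormallySmooth.liftOfSurjective_apply _ g hgs hnil x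
  let : Algebra V T := f.toRingHom.toAlgebra
  let : Module V (FPush p e T) := Module.compHom _ (algebraMap V T)
  have : IsScalarTower V T (FPush p e T) := IsScalarTower.of_algebraMap_smul fun _ _ => rfl
  let N := T ⊗[V] FPush p e V
  let j0 : V →+ N := (TensorProduct.mk V T (FPush p e V) 1).toAddMonoidHom.comp
    (FPush.of p e).toAddMonoidHom
  have hj0 (v w : V) : j0 (v ^ p ^ e * w) = f v • j0 w := by
    change (1 : T) ⊗ₜ[V] (v • FPush.of p e w) = f v • ((1 : T) ⊗ₜ[V] FPush.of p e w)
    rw [← TensorProduct.smul_tmul, TensorProduct.smul_tmul', Algebra.smul_def, smul_eq_mul]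
    rfl
  have hj0J : ∀ x ∈ J, j0 x = 0 := by
    intro x hx
    suffices ∀ w, j0 (x * w) = 0 by simpa using this 1
    refine Submodule.span_induction ?_ ?_ ?_ ?_ hx
    · rintro _ ⟨y, hy, rfl⟩ w
      rw [iterateFrobenius_def, hj0, (show f y = 0 from hy), zero_smul]
    · simp
    · intro x y _ _ hx hy w
      rw [add_mul, map_add, hx, hy, add_zero]
    · intro a x _ hx w
      rw [smul_eq_mul, mul_comm a, mul_assoc, hx]
  let j : V ⧸ J →+ N := QuotientAddGroup.lift J.toAddSubgroup j0 hj0J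
  have hj (v : V) : j (Ideal.Quotient.mk J v) = j0 v := rfl
  let i : FPush p e T →ₗ[T] N :=
    { toFun x := j (σ ((FPush.of p e).symm x))
      map_add' x y := by simp
      map_smul' t x := by
        obtain ⟨x, rfl⟩ := (FPush.of p e).surjective x
        rw [FPush.smul_of, AddEquiv.symm_apply_apply, AddEquiv.symm_apply_apply, map_mul, map_pow,
          RingHom.id_apply]
        obtain ⟨v, hv⟩ := Ideal.Quotient.mk_surjective (σ t)
        obtain ⟨w, hw⟩ := Ideal.Quotient.mk_surjective (σ x)
        -- T-linearity: v lifts σ t, so v^(p^e) acts on the tensor product as the scalar f v, which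
        -- is t because σ is a section.
        rw [← hv, ← hw, ← map_pow, ← map_mul, hj, hj, hj0, ← hg v, hv, hσ] }
  let s0 : FPush p e V →ₗ[V] FPush p e T :=
    { toFun x := FPush.of p e (f ((FPush.of p e).symm x))
      map_add' x y := by simp
      map_smul' a x := by
        obtain ⟨x, rfl⟩ := (FPush.of p e).surjective x
        rw [FPush.smul_of, AddEquiv.symm_apply_apply, AddEquiv.symm_apply_apply, map_mul, map_pow]
        rfl }
  let s : N →ₗ[T] FPush p e T := s0.liftBaseChange T
  refine Module.Projective.of_split i s (LinearMap.ext fun x => ?_)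
  obtain ⟨x, rfl⟩ := (FPush.of p e).surjective x
  change s (j (σ x)) = FPush.of p e x
  obtain ⟨w, hw⟩ := Ideal.Quotient.mk_surjective (σ x)
  rw [← hw, hj]
  change s ((1 : T) ⊗ₜ[V] FPush.of p e w) = _
  rw [LinearMap.liftBaseChange_tmul, one_smul]
  change FPush.of p e (f w) = _
  rw [← hg, hw, hσ]

/-- A localization of a quotient of a polynomial ring is also a quotient of a localization V of that
ring. V is Noetherian, so the kernel is finitely generated. -/
theorem projective_fPush_of_essFiniteType (p e : ℕ) [Fact p.Prime] (k : Type*) [Field k]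
    [ExpChar k p] (T : Type*) [CommRing T] [Nontrivial T] [ExpChar T p] [Algebra k T]
    [Algebra.EssFiniteType k T]
    [Algebra.FormallySmooth k T] : Module.Projective T (FPush p e T) := by
  let A := Algebra.EssFiniteType.subalgebra k T
  let M := Algebra.EssFiniteType.submonoid k T
  obtain ⟨n, f, hf⟩ := Algebra.FiniteType.iff_quotient_mvPolynomial''.1
    (inferInstance : Algebra.FiniteType k A)
  let P := MvPolynomial (Fin n) k
  let W : Submonoid P := M.comap f.toRingHom
  have hW : Submonoid.map f.toRingHom W = M := Submonoid.map_comap_eq_of_surjective hf M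
  have : IsLocalization (Submonoid.map f.toRingHom W) T := by
    rw [hW]
    infer_instance
  let V := Localization W
  let g0 : V →+* T := IsLocalization.map T f.toRingHom W.le_comap_map
  have hg0 (x : P) : g0 (algebraMap P V x) = algebraMap A T (f x) := IsLocalization.map_eq _ _
  let g : V →ₐ[k] T := { g0 with
    commutes' r := by
      change g0 (algebraMap k V r) = _
      rw [IsScalarTower.algebraMap_apply k P V, hg0, MvPolynomial.algebraMap_eq,
        MvPolynomial.algHom_C, ← IsScalarTower.algebraMap_apply] }
  have hg : Function.Surjective g :=
    IsLocalization.map_surjective_of_surjective W V T hf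
  have : IsNoetherianRing V := IsLocalization.isNoetherianRing W V inferInstance
  have : Nontrivial V := g0.domain_nontrivial
  have : ExpChar P p := expChar_of_injective_algebraMap (algebraMap k P).injective p
  have : ExpChar V p := expChar_of_injective_algebraMap (algebraMap k V).injective p
  have := projective_fPush_mvPolynomial p e (Fin n) k
  have : Module.Projective V (FPush p e V) := projective_fPush_of_isLocalization p e W
  exact projective_fPush_of_formallySmooth p e g hg (IsNoetherian.noetherian _)

end DiagFReg

/-! ### Tensor powers of essentially smooth algebras, and diagonal F-regularity. -/

namespace DiagFReg
open scoped TensorProduct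

section TensorPow

variable (k : Type u) (R : Type v) [Field k] [CommRing R] [Algebra k R] (n : ℕ)

variable {k R} in
/-- The algebra map out of a tensor power given by a family of algebra maps. -/
noncomputable def tensorPowLift {n : ℕ} {B : Type*} [CommRing B] [Algebra k B]
    (g : Fin n → R →ₐ[k] B) :
    TensorPow k R n →ₐ[k] B :=
  PiTensorProduct.liftAlgHom
    ((MultilinearMap.mkPiAlgebra k (Fin n) B).compLinearMap fun i => (g i).toLinearMap)
    (by simp) (by intro x y; simp [Finset.prod_mul_distrib])

variable {k R} in
theorem tensorPowLift_tprod {n : ℕ} {B : Type*} [CommRing B] [Algebra k B]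
    (g : Fin n → R →ₐ[k] B) (r : Fin n → R) :
    tensorPowLift g (PiTensorProduct.tprod k r) = ∏ i, g i (r i) := by
  simp [tensorPowLift, PiTensorProduct.liftAlgHom]

/-- The inclusion of the `i`-th factor into a tensor power. -/
noncomputable def tensorPowSingle {n : ℕ} (i : Fin n) : R →ₐ[k] TensorPow k R n :=
  PiTensorProduct.singleAlgHom (A := fun _ : Fin n => R) i

variable {k R} in
theorem tensorPowLift_single {n : ℕ} {B : Type*} [CommRing B] [Algebra k B]
    (g : Fin n → R →ₐ[k] B) (i : Fin n) (r : R) :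
    tensorPowLift g (tensorPowSingle k R i r) = g i r := by
  rw [tensorPowSingle, PiTensorProduct.singleAlgHom_apply, tensorPowLift_tprod,
    Finset.prod_eq_single i]
  · simp
  · intro j _ hj
    simp [hj]
  · simp

instance formallySmooth_tensorPow [Algebra.FormallySmooth k R] :
    Algebra.FormallySmooth k (TensorPow k R n) := by
  rw [Algebra.FormallySmooth.iff_comp_surjective]
  intro B _ _ I hI f
  choose g hg using fun i => Algebra.FormallySmooth.comp_surjective k R I hI
    (f.comp (tensorPowSingle k R i))
  refine ⟨tensorPowLift g, PiTensorProduct.algHom_ext fun i => ?_⟩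
  refine AlgHom.ext fun r => Eq.trans ?_ (AlgHom.congr_fun (hg i) r)
  exact congrArg (Ideal.Quotient.mkₐ k I) (tensorPowLift_single g i r)

theorem tprod_eq_prod_tensorPowSingle (f : Fin n → R) :
    PiTensorProduct.tprod k f = ∏ i, tensorPowSingle k R i (f i) := by
  have h := map_prod (PiTensorProduct.tprodMonoidHom (A := fun _ : Fin n => R) k)
    (fun i => Pi.mulSingle i (f i)) Finset.univ
  rw [Finset.univ_prod_mulSingle] at h
  exact h

theorem iSup_range_tensorPowSingle : ⨆ i : Fin n, (tensorPowSingle k R i).range = ⊤ := by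
  rw [eq_top_iff]
  rintro x -
  induction x using PiTensorProduct.induction_on with
  | smul_tprod r f =>
    refine Subalgebra.smul_mem _ ?_ r
    rw [tprod_eq_prod_tensorPowSingle]
    exact Subalgebra.prod_mem _ fun i _ =>
      (le_iSup (fun i => (tensorPowSingle k R i).range) i) ⟨f i, rfl⟩
  | add x y hx hy => exact add_mem hx hy

instance essFiniteType_tensorPow [Algebra.EssFiniteType k R] :
    Algebra.EssFiniteType k (TensorPow k R n) := by
  induction n with
  | zero =>
    refine Algebra.EssFiniteType.of_surjective (Algebra.ofId k _) ?_
    rw [← AlgHom.range_eq_top, eq_top_iff, ← iSup_range_tensorPowSingle, iSup_of_empty]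
    exact bot_le
  | succ n ih =>
    have : Algebra.EssFiniteType k (R ⊗[k] TensorPow k R n) :=
      Algebra.EssFiniteType.comp k R _
    let f : R ⊗[k] TensorPow k R n →ₐ[k] TensorPow k R (n + 1) :=
      Algebra.TensorProduct.productMap (tensorPowSingle k R 0)
        (tensorPowLift fun i => tensorPowSingle k R i.succ)
    refine Algebra.EssFiniteType.of_surjective f ?_
    rw [← AlgHom.range_eq_top, eq_top_iff, ← iSup_range_tensorPowSingle]
    refine iSup_le fun i => ?_
    rintro _ ⟨r, rfl⟩
    refine Fin.cases ?_ (fun i => ?_) i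
    · exact ⟨r ⊗ₜ 1, by simp [f]⟩
    · exact ⟨1 ⊗ₜ tensorPowSingle k R i r, by simp [f, tensorPowLift_single]⟩

end TensorPow

theorem isDiagonallyFRegular_of_isEssentiallySmooth (p : ℕ) [Fact p.Prime] (k : Type u) [Field k]
    [CharP k p] (R : Type v) [CommRing R] [Algebra k R] (h : IsEssentiallySmooth k R) :
    IsDiagonallyFRegular p k R := by
  obtain ⟨S, _, _, _, _, M, _, _⟩ := h
  have := Algebra.FormallySmooth.of_isLocalization (R := S) (Rₘ := R) M
  have : Algebra.FormallySmooth k R := Algebra.FormallySmooth.comp k S R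
  have := Algebra.EssFiniteType.of_isLocalization R M
  have : Algebra.EssFiniteType k R := Algebra.EssFiniteType.comp k S R
  intro n _
  refine Set.eq_univ_of_forall fun c r hr => ?_
  -- The zero ring is treated apart because it does not have characteristic p.
  cases subsingleton_or_nontrivial R
  · exact ⟨1, one_pos, 0, zero_mem _, Subsingleton.elim _ _⟩
  have : Nontrivial (TensorPow k R n) := (diagonalMap k R n).toRingHom.domain_nontrivial
  have : ExpChar k p := ExpChar.prime Fact.out
  have : ExpChar R p := expChar_of_injective_algebraMap (algebraMap k R).injective p
  have : ExpChar (TensorPow k R n) p :=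
    expChar_of_injective_algebraMap (algebraMap k (TensorPow k R n)).injective p
  have := Algebra.EssFiniteType.isNoetherianRing k R
  obtain ⟨e, he, φ, hφ, hr1⟩ :=
    exists_cartierMap_eq_one (p := p) (fun e => projective_fPush_of_essFiniteType p e k R) hr
  have := projective_fPush_of_essFiniteType p e k (TensorPow k R n)
  obtain ⟨ψ, hψ, hψφ⟩ :=
    exists_cartierMap_lift (diagonalMap k R n).toRingHom (diagonalMap_surjective k R n) hφ
  have h0 : φ ∈ (diagonalCartierAlgebra p k R n).deg e := ⟨hφ, ψ, hψ, hψφ⟩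
  have h1 := (diagonalCartierAlgebra p k R n).comp_mem
    ((diagonalCartierAlgebra p k R n).mulLeft_mem c) h0
  rw [zero_add] at h1
  exact ⟨e, he, _, h1, by simp [hr1]⟩

end DiagFReg

/-! ### Strong F-regularity: reducedness, local domains, normality. -/

namespace DiagFReg
open scoped TensorProduct nonZeroDivisors

theorem IsNDiagonallyFRegular.isStronglyFRegular {p : ℕ} {k : Type u} {R : Type v} [Field k]
    [CommRing R] [Algebra k R] {n : ℕ} [NeZero n] (h : IsNDiagonallyFRegular p k R n) :
    IsStronglyFRegular p R := by
  refine Set.eq_univ_of_forall fun c r hr => ?_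
  obtain ⟨e, he, φ, hφ, hc⟩ := Set.eq_univ_iff_forall.1 h c r hr
  exact ⟨e, he, φ, (diagonalCartierAlgebra p k R n).deg_le e hφ, hc⟩

/-- Every element in no minimal prime is sent to `1` by some Cartier map of positive degree. -/
theorem IsStronglyFRegular.exists_eq_one {p : ℕ} {R : Type*} [CommRing R]
    (hR : IsStronglyFRegular p R) {r : R} (hr : ∀ P ∈ minimalPrimes R, r ∉ P) :
    ∃ e, 0 < e ∧ ∃ φ ∈ cartierMaps p R e, φ r = 1 :=
  (Set.eq_univ_iff_forall.1 hR 1) r hr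

theorem IsStronglyFRegular.isReduced {p : ℕ} [Fact p.Prime] {R : Type*} [CommRing R]
    (hR : IsStronglyFRegular p R) : IsReduced R := by
  obtain ⟨e, he, φ, hφ, h1⟩ := hR.exists_eq_one (r := 1)
    fun P hP h => hP.isPrime.ne_top ((Ideal.eq_top_iff_one P).2 h)
  refine (isReduced_iff_pow_one_lt 2 one_lt_two).2 fun x hx => ?_
  have hp : 2 ≤ p ^ e := (Fact.out : p.Prime).two_le.trans (Nat.le_self_pow he.ne' p)
  have h0 := hφ x 1
  rw [pow_eq_zero_of_le hp hx, zero_mul, map_zero, h1, mul_one] at h0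
  exact h0.symm

theorem mem_nonZeroDivisors_of_notMem_minimalPrimes {R : Type*} [CommRing R] [IsReduced R]
    {r : R} (hr : ∀ P ∈ minimalPrimes R, r ∉ P) : r ∈ R⁰ := by
  have h : r ∉ ⋃ P ∈ (⊥ : Ideal R).minimalPrimes, (P : Set R) := by
    simpa using hr
  rw [Ideal.iUnion_minimalPrimes] at h
  rw [mem_nonZeroDivisors_iff_right]
  intro x hx
  by_contra hx0
  refine h ⟨x, ?_, ?_⟩
  · rwa [← Ideal.zero_eq_bot, ← nilradical, nilradical_eq_zero, Ideal.zero_eq_bot, Ideal.mem_bot]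
  · rw [mul_comm, hx]
    exact Ideal.zero_mem _

/-- If a lies in a minimal prime Q, then a is nilpotent in R_Q, and reducedness gives an s outside Q
killing a. So (a) + Ann(a) lies in no minimal prime, and prime avoidance supplies one element
outside all of them. -/
theorem exists_mul_eq_zero_notMem_minimalPrimes {R : Type*} [CommRing R] [IsReduced R]
    [IsNoetherianRing R] (a : R) :
    ∃ u b : R, a * b = 0 ∧ ∀ P ∈ minimalPrimes R, a * u + b ∉ P := by
  let I : Ideal R := Ideal.span {a} ⊔ (Submodule.span R {a}).annihilator
  have hI : ∀ Q ∈ minimalPrimes R, ¬ I ≤ Q := by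
    intro Q hQ hle
    have := hQ.isPrime
    have ha : a ∈ Q := hle (Ideal.mem_sup_left (Ideal.mem_span_singleton_self a))
    have h := IsLocalization.AtPrime.radical_map_of_mem_minimalPrimes
      (A := Localization.AtPrime Q) Q ⊥ hQ
    have h1 : algebraMap R (Localization.AtPrime Q) a ∈ (Ideal.map
        (algebraMap R (Localization.AtPrime Q)) ⊥).radical := h ▸ Ideal.mem_map_of_mem _ ha
    obtain ⟨n, hn⟩ := h1
    rw [Ideal.map_bot, Ideal.mem_bot, ← map_pow,
      IsLocalization.map_eq_zero_iff Q.primeCompl] at hn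
    obtain ⟨s, hs⟩ := hn
    have hsa : (s : R) * a = 0 := by
      refine eq_zero_of_pow_eq_zero (n := n + 1) ?_
      rw [mul_pow, pow_succ (s : R), pow_succ a]
      linear_combination (s : R) ^ n * a * hs
    refine s.2 (hle (Ideal.mem_sup_right ?_))
    rw [Submodule.mem_annihilator_span_singleton]
    exact hsa
  have h : ¬ (I : Set R) ⊆ ⋃ Q ∈ minimalPrimes R, (Q : Set R) := by
    rw [Ideal.subset_union_prime_finite (f := fun Q : Ideal R => Q)
      (minimalPrimes.finite_of_isNoetherianRing R) ⊥ ⊥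
      fun Q hQ _ _ => hQ.isPrime]
    rintro ⟨Q, hQ, hle⟩
    exact hI Q hQ hle
  rw [Set.not_subset] at h
  obtain ⟨c, hc, hcQ⟩ := h
  obtain ⟨y, hy, b, hb, rfl⟩ := Submodule.mem_sup.1 hc
  obtain ⟨u, rfl⟩ := Ideal.mem_span_singleton'.1 hy
  refine ⟨u, b, ?_, fun P hP hmem => hcQ ?_⟩
  · rw [Submodule.mem_annihilator_span_singleton] at hb
    rw [mul_comm]
    exact hb
  · rw [mul_comm] at hmem
    exact Set.mem_biUnion hP hmem

/-- Take c = a * u + b with a * b = 0, and φ c = 1. Then φ (a * u) and φ b have sum 1 and product 0,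
so they are complementary idempotents. If φ (a * u) were in P, the element φ b outside P would kill
a; otherwise φ (a * u) kills b, so c and a * u agree at P. -/
theorem IsStronglyFRegular.exists_algebraMap_eq {p : ℕ} [Fact p.Prime] {R : Type*} [CommRing R]
    [IsNoetherianRing R] (hR : IsStronglyFRegular p R) (P : Ideal R) [P.IsPrime] {a : R}
    (ha : algebraMap R (Localization.AtPrime P) a ≠ 0) :
    ∃ u c : R, (∀ Q ∈ minimalPrimes R, c ∉ Q) ∧
      algebraMap R (Localization.AtPrime P) c = algebraMap R (Localization.AtPrime P) (a * u) := by
  have := hR.isReduced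
  obtain ⟨u, b, hab, hc⟩ := exists_mul_eq_zero_notMem_minimalPrimes a
  obtain ⟨e, -, φ, hφ, h1⟩ := hR.exists_eq_one hc
  have hcd := mem_nonZeroDivisors_of_notMem_minimalPrimes hc
  refine ⟨u, a * u + b, hc, ?_⟩
  -- With c = x + y and q = p^e, x * y = 0 gives x^q * c = c^q * x; applying φ yields x * φ c = c *
  -- φ x.
  have key : ∀ x y : R, x * y = 0 → x + y = a * u + b → x = (a * u + b) * φ x := by
    intro x y hxy hc
    rw [← hc] at h1 ⊢
    have hx : x ^ p ^ e * (x + y) = (x + y) ^ p ^ e * x := by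
      obtain ⟨n, hn⟩ : ∃ n, p ^ e = n + 1 :=
        ⟨p ^ e - 1, (Nat.sub_add_cancel (pow_pos (Fact.out : p.Prime).pos e)).symm⟩
      have hpow : ∀ m : ℕ, (x + y) ^ m * x = x ^ (m + 1) := by
        intro m
        induction m with
        | zero => simp
        | succ m ih => rw [pow_succ, mul_assoc, add_mul, mul_comm y, hxy, add_zero, ← mul_assoc,
            ih, ← pow_succ]
      rw [hpow, hn, mul_add, pow_succ x n, mul_assoc (x ^ n) x y, hxy]
      ring
    rw [← hφ, ← hx, hφ, h1, mul_one]
  have hauB : a * u * b = 0 := by linear_combination u * hab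
  have ht := key (a * u) b hauB rfl
  have ht' := key b (a * u) (by rw [mul_comm, hauB]) (add_comm _ _)
  set c := a * u + b with hcdef
  have hsum : φ (a * u) + φ b = 1 := by rw [← map_add, h1]
  have hprod : φ (a * u) * φ b = 0 := by
    have h2 : (φ (a * u) * φ b) * (c * c) = 0 := by
      linear_combination hauB - b * ht - c * φ (a * u) * ht'
    exact (mem_nonZeroDivisors_iff_right.1 (mul_mem hcd hcd)) _ h2
  by_cases htP : φ (a * u) ∈ P
  · have ht'P : φ b ∈ P.primeCompl := fun h =>
      (Ideal.IsPrime.ne_top (I := P) inferInstance) ((Ideal.eq_top_iff_one P).2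
        (hsum ▸ add_mem htP h))
    refine absurd ((IsLocalization.map_eq_zero_iff P.primeCompl _ a).2 ⟨⟨φ b, ht'P⟩, ?_⟩) ha
    refine (mem_nonZeroDivisors_iff_right.1 hcd) _ ?_
    have h3 : φ b * (a * u) = 0 := by rw [ht]; linear_combination c * hprod
    change φ b * a * c = 0
    rw [hcdef]
    linear_combination φ b * hab + a * h3
  · rw [IsLocalization.eq_iff_exists P.primeCompl]
    refine ⟨⟨φ (a * u), htP⟩, ?_⟩
    change φ (a * u) * c = φ (a * u) * (a * u)
    have h3 : φ (a * u) * b = 0 := by rw [ht']; linear_combination c * hprod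
    rw [hcdef, mul_add, h3, add_zero]

theorem IsStronglyFRegular.isDomain_localization {p : ℕ} [Fact p.Prime] {R : Type*} [CommRing R]
    [IsNoetherianRing R] (hR : IsStronglyFRegular p R) (P : Ideal R) [P.IsPrime] :
    IsDomain (Localization.AtPrime P) := by
  have := hR.isReduced
  have : NoZeroDivisors (Localization.AtPrime P) := by
    refine ⟨fun {x y} hxy => or_iff_not_imp_left.2 fun hx => ?_⟩
    obtain ⟨a, s, rfl⟩ := IsLocalization.exists_mk'_eq P.primeCompl x
    have ha : algebraMap R (Localization.AtPrime P) a ≠ 0 := fun h => hx (by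
      rw [IsLocalization.mk'_eq_mul_mk'_one, h, zero_mul])
    obtain ⟨u, c, hc, hcu⟩ := hR.exists_algebraMap_eq P ha
    have hcd := IsLocalization.map_nonZeroDivisors_le P.primeCompl (Localization.AtPrime P)
      ⟨c, mem_nonZeroDivisors_of_notMem_minimalPrimes hc, rfl⟩
    refine (mem_nonZeroDivisors_iff_left.1 hcd) _ ?_
    change algebraMap R _ c * y = 0
    have hs := IsLocalization.mk'_spec (Localization.AtPrime P) a s
    rw [hcu, map_mul, ← hs]
    linear_combination algebraMap R _ (s : R) * algebraMap R _ u * hxy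
  exact NoZeroDivisors.to_isDomain _

theorem IsStronglyFRegular.exists_eq_one_localization {p : ℕ} [Fact p.Prime] {R : Type*}
    [CommRing R] [CharP R p] [IsNoetherianRing R] (hR : IsStronglyFRegular p R) (P : Ideal R)
    [P.IsPrime] [CharP (Localization.AtPrime P) p] {x : Localization.AtPrime P} (hx : x ≠ 0) :
    ∃ e, 0 < e ∧ ∃ φ ∈ cartierMaps p (Localization.AtPrime P) e, φ x = 1 := by
  have : ExpChar R p := ExpChar.prime Fact.out
  have : ExpChar (Localization.AtPrime P) p := ExpChar.prime Fact.out
  obtain ⟨a, s, rfl⟩ := IsLocalization.exists_mk'_eq P.primeCompl x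
  have ha : algebraMap R (Localization.AtPrime P) a ≠ 0 := fun h => hx (by
    rw [IsLocalization.mk'_eq_mul_mk'_one, h, zero_mul])
  obtain ⟨u, c, hc, hcu⟩ := hR.exists_algebraMap_eq P ha
  obtain ⟨e, he, φ, hφ, h1⟩ := hR.exists_eq_one hc
  obtain ⟨ψ, hψ, hψφ⟩ := exists_cartierMap_localization p e (V := Localization.AtPrime P)
    P.primeCompl hφ
  refine ⟨e, he, ψ.comp (AddMonoidHom.mulLeft (algebraMap R _ (s * u))), ?_, ?_⟩
  · exact IsCartierMap.comp (e := 0) hψ (isCartierMap_mulLeft p _)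
  · rw [AddMonoidHom.comp_apply, AddMonoidHom.coe_mulLeft, map_mul (algebraMap R _), mul_right_comm,
      IsLocalization.mk'_spec', ← map_mul, ← hcu, hψφ, h1, map_one]

/-- An integral fraction a / b is almost integral: some c ≠ 0 has c * (a / b)^n in A for all n. With
φ c = 1 and n = p^e, applying φ to a^n * c = b^n * d gives a = b * φ d. -/
theorem isIntegrallyClosed_of_exists_cartierMap {p : ℕ} {A : Type*} [CommRing A] [IsDomain A]
    (hA : ∀ x : A, x ≠ 0 → ∃ e, 0 < e ∧ ∃ φ ∈ cartierMaps p A e, φ x = 1) :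
    IsIntegrallyClosed A := by
  rw [isIntegrallyClosed_iff (FractionRing A)]
  intro x hx
  obtain ⟨c, hc, hcx⟩ := hx.isAlmostIntegral
  obtain ⟨a, b, rfl⟩ := IsLocalization.exists_mk'_eq A⁰ x
  obtain ⟨e, -, φ, hφ, h1⟩ := hA c (nonZeroDivisors.ne_zero hc)
  obtain ⟨d, hd⟩ := hcx (p ^ e)
  have h : a ^ p ^ e * c = (b : A) ^ p ^ e * d := by
    refine IsFractionRing.injective A (FractionRing A) ?_
    rw [map_mul, map_mul, map_pow, map_pow, hd, Algebra.smul_def,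
      ← IsLocalization.mk'_spec (FractionRing A) a b, mul_pow]
    ring
  refine ⟨φ d, ?_⟩
  rw [eq_comm, IsLocalization.mk'_eq_iff_eq_mul, ← map_mul]
  congr 1
  rw [mul_comm, ← hφ, ← h, hφ, h1, mul_one]

theorem IsStronglyFRegular.isNormalRing {p : ℕ} [Fact p.Prime] (k : Type u) [Field k]
    [CharP k p] {R : Type v} [CommRing R] [Algebra k R] [Algebra.EssFiniteType k R]
    (hR : IsStronglyFRegular p R) : IsNormalRing R := by
  intro P _
  have : IsNoetherianRing R := Algebra.EssFiniteType.isNoetherianRing k R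
  have : Nontrivial R := (algebraMap R (Localization.AtPrime P)).domain_nontrivial
  have : CharP R p := charP_of_injective_algebraMap (algebraMap k R).injective p
  have : CharP (Localization.AtPrime P) p :=
    charP_of_injective_algebraMap (algebraMap k (Localization.AtPrime P)).injective p
  have := hR.isDomain_localization P
  exact ⟨this, isIntegrallyClosed_of_exists_cartierMap fun _ hx =>
    hR.exists_eq_one_localization P hx⟩

end DiagFReg

/-! ### Regular parameters in localizations of polynomial rings. -/

namespace DiagFReg
open RingTheory.Sequence IsLocalRing Polynomial

/-- The maximal ideal of a local ring is generated by a regular sequence. -/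
def HasRegularParameters (A : Type*) [CommRing A] [IsLocalRing A] : Prop :=
  ∃ rs : List A, IsWeaklyRegular A rs ∧ Ideal.ofList rs = maximalIdeal A

theorem HasRegularParameters.of_ringEquiv {A B : Type*} [CommRing A] [IsLocalRing A] [CommRing B]
    [IsLocalRing B] (e : A ≃+* B) (h : HasRegularParameters A) : HasRegularParameters B := by
  obtain ⟨rs, hrs, hm⟩ := h
  algebraize [e.toRingHom]
  have : Module.Flat A B := RingHom.Flat.of_bijective (f := e.toRingHom) e.bijective
  refine ⟨_, hrs.of_flat (S := B), ?_⟩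
  rw [← Ideal.map_ofList, hm]
  exact map_ringEquiv_maximalIdeal e

theorem HasRegularParameters.localization_of_weaklyRegular {R : Type*} [CommRing R] (p : Ideal R)
    [p.IsPrime] {rs : List R} (hrs : IsWeaklyRegular R rs) (hp : Ideal.ofList rs = p) :
    HasRegularParameters (Localization.AtPrime p) := by
  refine ⟨_, hrs.of_isLocalization (Localization.AtPrime p) p.primeCompl, ?_⟩
  rw [← Ideal.map_ofList, hp, Localization.AtPrime.map_eq_maximalIdeal]

/-- A prime p over the maximal ideal m is either mR[X] or mR[X] + (y). In the second case y lies
outside the prime mR[X], so it is regular modulo mR[X] and extends the sequence. -/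
theorem HasRegularParameters.localization_polynomial {R : Type*} [CommRing R] [IsLocalRing R]
    (h : HasRegularParameters R) (p : Ideal R[X]) [p.IsPrime] (hp : p.comap C = maximalIdeal R) :
    HasRegularParameters (Localization.AtPrime p) := by
  obtain ⟨rs, hrs, hm⟩ := h
  have hrs' := hrs.of_flat (S := R[X])
  have hm' : Ideal.ofList (rs.map (algebraMap R R[X])) = (maximalIdeal R).map C := by
    rw [← Ideal.map_ofList, hm, algebraMap_eq]
  by_cases hpq : p = (maximalIdeal R).map C
  · exact localization_of_weaklyRegular p hrs' (hm'.trans hpq.symm)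
  · have hmax : (p.comap C).IsMaximal := hp ▸ maximalIdeal.isMaximal R
    obtain ⟨y, -, hy⟩ := exists_monic_span_sup_map_eq R p hmax (by rwa [hp])
    rw [hp] at hy
    refine localization_of_weaklyRegular p (rs := rs.map (algebraMap R R[X]) ++ [y]) ?_ ?_
    · rw [isWeaklyRegular_append_iff, isWeaklyRegular_singleton_iff,
        isSMulRegular_quotient_iff_mem_of_smul_mem, hm', smul_eq_mul, Ideal.mul_top]
      refine ⟨hrs', fun x hx => ?_⟩
      have : ((maximalIdeal R).map C).IsPrime := Ideal.isPrime_map_C_of_isPrime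
      refine (this.mem_or_mem hx).resolve_left fun h => hpq ?_
      rw [hy, sup_eq_left, Ideal.span_singleton_le_iff_mem]
      exact h
    · rw [Ideal.ofList_append, hm', Ideal.ofList_singleton, ← hy]

/-- All localizations at primes have their maximal ideal generated by a regular sequence. -/
def HasLocalRegularParameters (R : Type*) [CommRing R] : Prop :=
  ∀ (p : Ideal R) [p.IsPrime], HasRegularParameters (Localization.AtPrime p)

theorem HasLocalRegularParameters.of_ringEquiv {R S : Type*} [CommRing R] [CommRing S]
    (e : R ≃+* S) (h : HasLocalRegularParameters R) : HasLocalRegularParameters S := by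
  intro p _
  exact (h (p.comap e)).of_ringEquiv
    (Localization.localRingEquiv (p.comap e) p e rfl)

theorem HasLocalRegularParameters.polynomial {R : Type*} [CommRing R]
    (h : HasLocalRegularParameters R) : HasLocalRegularParameters R[X] := by
  intro p _
  -- Localizing the coefficients at q reduces to a local base ring with p lying over its maximal
  -- ideal.
  let q := p.comap C
  let S := (Localization.AtPrime q)[X]
  let pc := Submonoid.map Polynomial.C.toMonoidHom q.primeCompl
  let : Algebra R[X] S := algebra R (Localization.AtPrime q)
  have : IsLocalization pc S := Polynomial.isLocalization _ _
  let pS := p.map (algebraMap R[X] S)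
  have disj : Disjoint (pc : Set R[X]) (p : Set R[X]) := by
    simpa [pc, q] using! Set.disjoint_image_left.mpr
      (Set.disjoint_compl_left_iff_subset.mpr (fun _ a ↦ a))
  have : pS.IsPrime := IsLocalization.isPrime_of_isPrime_disjoint pc _ _ ‹_› disj
  have : IsLocalization.AtPrime (Localization.AtPrime pS) p := by
    convert IsLocalization.isLocalization_isLocalization_atPrime_isLocalization pc
      (Localization.AtPrime pS) pS
    exact (IsLocalization.under_map_of_isPrime_disjoint pc _ ‹_› disj).symm
  have eq : pS.comap C = maximalIdeal (Localization.AtPrime q) := by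
    rw [← IsLocalization.map_under q.primeCompl _ (pS.comap C),
      ← IsLocalization.map_under q.primeCompl _ (maximalIdeal (Localization.AtPrime q))]
    simp only [Ideal.comap_comap, S, pS]
    rw [← Polynomial.algebraMap_eq (R := Localization.AtPrime q),
      ← IsScalarTower.algebraMap_eq R (Localization.AtPrime q) (Localization.AtPrime q)[X],
      IsScalarTower.algebraMap_eq R R[X] (Localization.AtPrime q)[X], ← Ideal.comap_comap,
      ← Ideal.under_def R[X], IsLocalization.under_map_of_isPrime_disjoint pc _ ‹_› disj]
    simp [q, IsLocalization.AtPrime.under_maximalIdeal (Localization.AtPrime q) q]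
  exact ((h q).localization_polynomial pS eq).of_ringEquiv
    (IsLocalization.algEquiv p.primeCompl (Localization.AtPrime pS)
      (Localization.AtPrime p)).toRingEquiv

theorem hasLocalRegularParameters_of_field (k : Type*) [Field k] :
    HasLocalRegularParameters k := by
  intro p hp
  refine HasRegularParameters.localization_of_weaklyRegular p (IsWeaklyRegular.nil k k) ?_
  rw [Ideal.ofList_nil]
  exact ((Ideal.eq_bot_or_top p).resolve_right hp.ne_top).symm

theorem hasLocalRegularParameters_mvPolynomial (k : Type*) [Field k] (n : ℕ) :
    HasLocalRegularParameters (MvPolynomial (Fin n) k) := by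
  induction n with
  | zero =>
    exact HasLocalRegularParameters.of_ringEquiv (MvPolynomial.isEmptyRingEquiv k (Fin 0)).symm
      (hasLocalRegularParameters_of_field k)
  | succ n ih =>
    exact HasLocalRegularParameters.of_ringEquiv
      (MvPolynomial.finSuccEquiv k n).toRingEquiv.symm ih.polynomial

end DiagFReg

/-! ### Flatness over a Noether normalization, and Cohen–Macaulayness. -/

namespace DiagFReg
open RingTheory.Sequence IsLocalRing

/-- A maximal linearly independent subfamily of a finite generating family spans a free submodule
that contains a nonzero multiple of each generator. The product of these multipliers sends all of B
into it. -/
theorem exists_smul_factors_through_free (S B : Type*) [CommRing S] [IsDomain S] [AddCommGroup B]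
    [Module S B] [Module.Finite S B] :
    ∃ c : S, c ≠ 0 ∧ ∃ (ι : Type) (_ : Fintype ι) (f : B →ₗ[S] (ι → S)) (h : (ι → S) →ₗ[S] B),
      ∀ b, h (f b) = c • b := by
  classical
  obtain ⟨n, v, hv⟩ := Module.Finite.exists_fin (R := S) (M := B)
  obtain ⟨J, hJ, hmax⟩ := exists_maximal_linearIndepOn S v
  let b := Module.Basis.span hJ
  have hW : Set.range (fun x : J => v x) = v '' J := (Set.image_eq_range v J).symm
  have hmem : ∀ i, ∃ a : S, a ≠ 0 ∧ a • v i ∈ Submodule.span S (Set.range fun x : J => v x) := by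
    intro i
    by_cases hi : i ∈ J
    · exact ⟨1, one_ne_zero, by
        rw [one_smul]
        exact Submodule.subset_span ⟨⟨i, hi⟩, rfl⟩⟩
    · rw [hW]
      exact hmax i hi
  choose a ha hav using hmem
  have hc : ∀ x : B, (∏ i, a i) • x ∈ Submodule.span S (Set.range fun x : J => v x) := by
    intro x
    have hx : x ∈ Submodule.span S (Set.range v) := hv ▸ Submodule.mem_top
    induction hx using Submodule.span_induction with
    | mem x hx =>
      obtain ⟨i, rfl⟩ := hx
      rw [← Finset.prod_erase_mul _ _ (Finset.mem_univ i), mul_smul]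
      exact Submodule.smul_mem _ _ (hav i)
    | zero => rw [smul_zero]; exact Submodule.zero_mem _
    | add x y _ _ hx hy => rw [smul_add]; exact Submodule.add_mem _ hx hy
    | smul t x _ hx => rw [smul_comm]; exact Submodule.smul_mem _ _ hx
  refine ⟨∏ i, a i, Finset.prod_ne_zero_iff.2 fun i _ => ha i, J, inferInstance,
    b.equivFun.toLinearMap ∘ₗ (LinearMap.lsmul S B (∏ i, a i)).codRestrict _ hc,
    Submodule.subtype _ ∘ₗ b.equivFun.symm.toLinearMap, fun x => ?_⟩
  change ((b.equivFun.symm (b.equivFun _) : Submodule.span S _) : B) = _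
  rw [LinearEquiv.symm_apply_apply]
  rfl

theorem flat_of_exists_cartierMap {p : ℕ} [Fact p.Prime] {S B A : Type*} [CommRing S] [IsDomain S]
    [CommRing B] [CommRing A] [IsDomain A] [Algebra S B] [Algebra B A] [Algebra S A]
    [IsScalarTower S B A] [Module.Finite S B] [ExpChar S p] [CharP B p] (M : Submonoid B)
    [IsLocalization M A] (hBA : Function.Injective (algebraMap B A))
    (hSB : Function.Injective (algebraMap S B))
    (hS : ∀ e, Module.Projective S (FPush p e S))
    (hA : ∀ x : A, x ≠ 0 → ∃ e, 0 < e ∧ ∃ φ ∈ cartierMaps p A e, φ x = 1) :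
    Module.Flat S A := by
  have : ExpChar B p := ExpChar.prime Fact.out
  obtain ⟨c, hc, ι, _, f, h, hfh⟩ := exists_smul_factors_through_free S B
  have hcA : algebraMap B A (algebraMap S B c) ≠ 0 :=
    (map_ne_zero_iff _ hBA).2 ((map_ne_zero_iff _ hSB).2 hc)
  obtain ⟨e, -, φ, hφ, h1⟩ := hA _ hcA
  have := hS e
  have : Module.Projective S (ι → FPush p e S) := by
    classical
    exact Module.Projective.of_equiv
      (DFinsupp.linearEquivFunOnFintype (R := S) (M := fun _ : ι => FPush p e S))
  let θ₁ : B →ₗ[S] (ι → FPush p e S) :=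
    { toFun b i := FPush.of p e (f (b ^ p ^ e) i)
      map_add' x y := by
        ext i
        rw [add_pow_expChar_pow, map_add, Pi.add_apply, map_add, Pi.add_apply]
      map_smul' s x := by
        ext i
        rw [smul_pow, map_smul, Pi.smul_apply, smul_eq_mul, RingHom.id_apply, Pi.smul_apply,
          FPush.smul_of] }
  let θ₂ : (ι → FPush p e S) →ₗ[S] A :=
    { toFun w := φ (algebraMap B A (h fun i => (FPush.of p e).symm (w i)))
      map_add' x y := by
        rw [← map_add, ← map_add, ← map_add]
        congr 3
      map_smul' s x := by
        have : (fun i => (FPush.of p e).symm ((s • x) i)) =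
            s ^ p ^ e • fun i => (FPush.of p e).symm (x i) := rfl
        rw [this, map_smul, Algebra.smul_def, map_mul, map_pow, map_pow, hφ, RingHom.id_apply,
          Algebra.smul_def, IsScalarTower.algebraMap_apply S B A] }
  -- The composite is b ↦ φ (c * b^(p^e)) = b * φ c = b.
  have hθ (b : B) : θ₂ (θ₁ b) = algebraMap B A b := by
    change φ (algebraMap B A (h (f (b ^ p ^ e)))) = _
    rw [hfh, Algebra.smul_def, map_mul, map_pow, mul_comm, hφ, h1, mul_one]
  -- Equational criterion: clear denominators to move a relation from A to B, trivialize its image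
  -- under θ₁ in the flat middle module, return by θ₂ and divide by the denominator m.
  refine Module.Flat.of_forall_isTrivialRelation fun {l s x} hsx => ?_
  obtain ⟨m, hm⟩ := IsLocalization.exist_integer_multiples_of_finite M x
  choose b hb using hm
  have hb' (i) : algebraMap B A (b i) = algebraMap B A m * x i := by
    rw [hb]
    exact Algebra.smul_def _ _
  have h0 : ∑ i, s i • θ₁ (b i) = 0 := by
    have h2 (i) : algebraMap B A (s i • b i) = algebraMap B A m * (s i • x i) := by
      rw [Algebra.smul_def, map_mul, ← IsScalarTower.algebraMap_apply, hb', Algebra.smul_def]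
      ring
    have h3 : ∑ i, s i • b i = 0 := by
      refine hBA ?_
      rw [map_sum, map_zero, Finset.sum_congr rfl fun i _ => h2 i, ← Finset.mul_sum, hsx, mul_zero]
    rw [← map_zero θ₁, ← h3, map_sum]
    exact Finset.sum_congr rfl fun i _ => (map_smul θ₁ _ _).symm
  obtain ⟨r, a, y, hy, ha⟩ := Module.Flat.isTrivialRelation_of_sum_smul_eq_zero h0
  obtain ⟨m', hm'⟩ := (IsLocalization.map_units A m).exists_left_inv
  refine ⟨r, a, fun j => m' * θ₂ (y j), fun i => ?_, ha⟩
  have h2 : algebraMap B A m * x i = ∑ j, a i j • θ₂ (y j) := by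
    rw [← hb', ← hθ, show θ₁ (b i) = _ from hy i, map_sum]
    exact Finset.sum_congr rfl fun j _ => map_smul θ₂ _ _
  simp_rw [← mul_smul_comm]
  rw [← Finset.mul_sum, ← h2, ← mul_assoc, hm', one_mul]

theorem isCohenMacaulayLocal_of_flat {S B A : Type*} [CommRing S] [CommRing B] [CommRing A]
    [IsLocalRing A] [IsNoetherianRing A] [Algebra S B] [Algebra B A] [Algebra S A]
    [IsScalarTower S B A] [Algebra.IsIntegral S B] (M : Submonoid B) [IsLocalization M A]
    [Module.Flat S A] (hS : HasLocalRegularParameters S) : IsCohenMacaulayLocal A := by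
  let q : Ideal S := (maximalIdeal A).comap (algebraMap S A)
  have hq : ∀ y : q.primeCompl, IsUnit (algebraMap S A y) := fun y => by
    by_contra hy
    exact y.2 hy
  let g : Localization.AtPrime q →+* A := IsLocalization.lift hq
  have hg (s : S) : g (algebraMap S _ s) = algebraMap S A s := IsLocalization.lift_eq hq s
  let : Algebra (Localization.AtPrime q) A := g.toAlgebra
  have : IsScalarTower S (Localization.AtPrime q) A :=
    IsScalarTower.of_algebraMap_eq fun s => (hg s).symm
  have : Module.Flat (Localization.AtPrime q) A :=
    (Module.flat_iff_of_isLocalization (Localization.AtPrime q) q.primeCompl A).2 inferInstance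
  obtain ⟨rs, hrs, hm⟩ := hS q
  have hrsA := hrs.of_flat (S := A)
  have hmap : Ideal.ofList (rs.map (algebraMap (Localization.AtPrime q) A)) =
      q.map (algebraMap S A) := by
    rw [← Ideal.map_ofList, hm, ← Localization.AtPrime.map_eq_maximalIdeal, Ideal.map_map,
      ← IsScalarTower.algebraMap_eq]
  have hqle : q.map (algebraMap S A) ≤ maximalIdeal A := Ideal.map_comap_le
  have hmem : ∀ x ∈ rs.map (algebraMap (Localization.AtPrime q) A), x ∈ maximalIdeal A :=
    fun x hx => hqle (hmap ▸ Ideal.subset_span hx)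
  have hreg := (IsLocalRing.isRegular_iff_isWeaklyRegular_of_subset_maximalIdeal hmem).2 hrsA
  refine ⟨_, hmem, hreg, ?_⟩
  rw [← ringKrullDim_add_length_eq_ringKrullDim_of_isRegular _ hreg, hmap]
  have hnt : Nontrivial (A ⧸ q.map (algebraMap S A)) :=
    Ideal.Quotient.nontrivial_iff.2 (ne_top_of_le_ne_top (maximalIdeal.isMaximal A).ne_top hqle)
  have hcomap (I : Ideal A) :
      (I.comap (algebraMap B A)).comap (algebraMap S B) = I.comap (algebraMap S A) := by
    rw [Ideal.comap_comap, ← IsScalarTower.algebraMap_eq]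
  -- Incomparability for the integral extension S → B: a prime of A containing qA and strictly below
  -- the maximal ideal would contract to a prime of S strictly below q.
  have hdim : Ring.KrullDimLE 0 (A ⧸ q.map (algebraMap S A)) := by
    refine Ring.krullDimLE_zero_iff.2 fun J hJ => ?_
    let J' := J.comap (Ideal.Quotient.mk (q.map (algebraMap S A)))
    have hqJ : q ≤ J'.comap (algebraMap S A) := by
      rw [← Ideal.map_le_iff_le_comap]
      intro x hx
      rw [Ideal.mem_comap, Ideal.Quotient.eq_zero_iff_mem.2 hx]
      exact J.zero_mem
    have hJle : J' ≤ maximalIdeal A := le_maximalIdeal (Ideal.IsPrime.ne_top inferInstance)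
    have hJ' : J' = maximalIdeal A := by
      by_contra hne
      have hlt : J'.comap (algebraMap B A) < (maximalIdeal A).comap (algebraMap B A) := by
        refine lt_of_le_of_ne (Ideal.comap_mono hJle) fun h => hne ?_
        rw [← IsLocalization.map_under M A J', ← IsLocalization.map_under M A (maximalIdeal A)]
        exact congrArg _ h
      have h2 := Ideal.IsIntegral.comap_lt_comap (R := S) hlt
      rw [hcomap, hcomap] at h2
      exact h2.not_ge hqJ
    have : J = J'.map (Ideal.Quotient.mk (q.map (algebraMap S A))) :=
      (Ideal.map_comap_of_surjective _ Ideal.Quotient.mk_surjective J).symm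
    rw [this, hJ']
    refine Ideal.IsMaximal.map_of_surjective_of_ker_le Ideal.Quotient.mk_surjective ?_
    rwa [Ideal.mk_ker]
  rw [ringKrullDimZero_iff_ringKrullDim_eq_zero.1 hdim, zero_add]

theorem IsStronglyFRegular.isCohenMacaulayRing {p : ℕ} [Fact p.Prime] (k : Type u) [Field k]
    [CharP k p] {R : Type v} [CommRing R] [Algebra k R] [Algebra.EssFiniteType k R]
    (hR : IsStronglyFRegular p R) : IsCohenMacaulayRing R := by
  intro P _
  let A := Localization.AtPrime P
  have : IsNoetherianRing R := Algebra.EssFiniteType.isNoetherianRing k R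
  have : Nontrivial R := (algebraMap R A).domain_nontrivial
  have : CharP R p := charP_of_injective_algebraMap (algebraMap k R).injective p
  have : CharP A p := charP_of_injective_algebraMap (algebraMap k A).injective p
  have : IsDomain A := hR.isDomain_localization P
  let B := Algebra.EssFiniteType.subalgebra k A
  have : CharP B p := charP_of_injective_algebraMap (algebraMap k B).injective p
  -- Noether normalization of the finitely generated subalgebra B, of which A is a localization.
  obtain ⟨s, g, hg, hfin⟩ := exists_finite_inj_algHom_of_fg k B
  let S := MvPolynomial (Fin s) k
  let : Algebra S B := g.toRingHom.toAlgebra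
  let : Algebra S A := ((algebraMap B A).comp g.toRingHom).toAlgebra
  have : IsScalarTower S B A := IsScalarTower.of_algebraMap_eq fun _ => rfl
  have : Module.Finite S B := hfin
  have : ExpChar k p := ExpChar.prime Fact.out
  have : ExpChar S p := expChar_of_injective_algebraMap (algebraMap k S).injective p
  have : Module.Flat S A :=
    flat_of_exists_cartierMap (B := B) (Algebra.EssFiniteType.submonoid k A)
      Subtype.val_injective hg (fun e => projective_fPush_mvPolynomial p e (Fin s) k)
      fun _ hx => hR.exists_eq_one_localization P hx
  exact isCohenMacaulayLocal_of_flat (B := B) (Algebra.EssFiniteType.submonoid k A)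
    (hasLocalRegularParameters_mvPolynomial k s)

end DiagFReg

theorem proposition5p1 (p : ℕ) [Fact p.Prime] (k : Type u) [Field k] [CharP k p]
    (R : Type v) [CommRing R] [Algebra k R] :
    (DiagFReg.IsEssentiallySmooth k R → DiagFReg.IsDiagonallyFRegular p k R) ∧
    (Algebra.EssFiniteType k R → ∀ (n : ℕ) [NeZero n], DiagFReg.IsNDiagonallyFRegular p k R n →
      DiagFReg.IsStronglyFRegular p R ∧ DiagFReg.IsNormalRing R ∧
        DiagFReg.IsCohenMacaulayRing R) := by
  refine ⟨DiagFReg.isDiagonallyFRegular_of_isEssentiallySmooth p k R, fun _ n _ h => ?_⟩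
  have hR : DiagFReg.IsStronglyFRegular p R := h.isStronglyFRegular
  exact ⟨hR, hR.isNormalRing k, hR.isCohenMacaulayRing k⟩
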